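/- A right loop is a set $S$ with a binary operation $\circ$ and a two-sided identity $1$ such that for all $a,b\in S$ the equation $X\circ a=b$ has a unique solution $X\in S$. For $y,z\in S$ let $f^S(y,z)$ be the permutation of $S$ that sends $x$ to the unique solution $X$ of $X\circ(y\circ z)=(x\circ y)\circ z$. The group torsion $G_S$ is the subgroup of $\mathrm{Sym}(S)$ generated by all $f^S(y,z)$. A congruence on $S$ is an equivalence relation on $S$ that is a right subloop of $S\times S$; the class $T$ of $1$ under a congruence $R$ determines $R$, and $S/T$ denotes the quotient right loop $S/R$. The natural projection $S\to S/T$ induces an onto group homomorphism $G_S\to G_{S/T}$ with $f^S(y,z)\mapsto f^{S/T}(T\circ y,T\circ z)$. A congruence $\alpha$ on $S$ is central if it is centralized by $S\times S$, that is, if there is a congruence $\delta$ on the right loop $\alpha\subseteq S\times S$ such that, for all elements of $\alpha$ involved: (i) for every $(x,y)\in\alpha$, the map $(u,v)\mapsto u$ is a bijection from the $\delta$-class of $(x,y)$ onto $S$; (ii) $(x,x)\,\delta\,(y,y)$ for all $x,y\in S$; (iii) $(x,y)\,\delta\,(u,v)$ implies $(y,x)\,\delta\,(v,u)$; (iv)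 $(x,y)\,\delta\,(u,v)$ and $(y,z)\,\delta\,(v,w)$ imply $(x,z)\,\delta\,(u,w)$. There is a greatest central congruence $\zeta(S)$; the center $\mathcal Z(S)$ is the class of $1$ under $\zeta(S)$, and it is an abelian group. A right loop $S$ is nilpotent if for some $n$ it has a central series $\{1\}=\mathcal Z_0\le\mathcal Z_1\le\cdots\le\mathcal Z_n=S$, where each $\mathcal Z_i$ is the class of $1$ under a congruence and $\mathcal Z_{i+1}/\mathcal Z_i=\mathcal Z(S/\mathcal Z_i)$ for $0\le i<n$. Proposition. Let $S$ be a nilpotent right loop with central series $\{1\}=\mathcal Z_0\le\mathcal Z_1\le\cdots\le\mathcal Z_n=S$, $n\ge 1$, and for $0\le j\le n-1$ let $\theta_j:G_S\to G_{S/\mathcal Z_j}$ be the homomorphism induced by the natural projection $S\to S/\mathcal Z_j$. Then $$\{1\}=\mathrm{Ker}\,\theta_0\le\mathrm{Ker}\,\theta_1\le\cdots\le\mathrm{Ker}\,\theta_{n-1}=G_S,$$ and for every $0\le j<n-1$ the group $\mathrm{Ker}\,\theta_{j+1}/\mathrm{Ker}\,\theta_j$ is isomorphic to a subgroup of a direct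 power $\prod_{\mathcal B}\mathcal Z_{j+1}/\mathcal Z_j$ of the abelian group $\mathcal Z_{j+1}/\mathcal Z_j$, for some index set $\mathcal B$. -/

import Mathlib

universe u

/-- A right loop: a binary operation with a two-sided identity `1` (this part is `MulOneClass`) such
that every equation `X * a = b` has a unique solution `X`. -/
class IsRightLoop (S : Type*) [MulOneClass S] : Prop where
  existsUnique_mul_eq : ∀ a b : S, ∃! x : S, x * a = b

namespace RightLoop

section Basic

variable {S : Type u} [MulOneClass S]

theorem mul_right_cancel' [IsRightLoop S] {x y a : S} (h : x * a = y * a) : x = y :=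
  (IsRightLoop.existsUnique_mul_eq a (y * a)).unique h rfl

/-- The unique solution `X` of `X * a = b`. -/
noncomputable def rdiv [IsRightLoop S] (b a : S) : S :=
  (IsRightLoop.existsUnique_mul_eq a b).choose

theorem rdiv_mul [IsRightLoop S] (b a : S) : rdiv b a * a = b :=
  (IsRightLoop.existsUnique_mul_eq a b).choose_spec.1

theorem mul_rdiv [IsRightLoop S] (b a : S) : rdiv (b * a) a = b :=
  mul_right_cancel' (rdiv_mul _ _)

/-- The permutation `f(y,z)` of `S`: it sends `x` to the unique solution `X` of
`X * (y * z) = (x * y) * z`. -/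
noncomputable def torsionMap [IsRightLoop S] (y z : S) : Equiv.Perm S where
  toFun x := rdiv ((x * y) * z) (y * z)
  invFun w := rdiv (rdiv (w * (y * z)) z) y
  left_inv x := by simp only [rdiv_mul, mul_rdiv]
  right_inv w := by simp only [rdiv_mul, mul_rdiv]

theorem torsionMap_mul [IsRightLoop S] (x y z : S) :
    torsionMap y z x * (y * z) = (x * y) * z :=
  rdiv_mul _ _

variable (S) in
/-- The group torsion `G_S`: the subgroup of `Sym(S)` generated by all `f(y,z)`. -/
def groupTorsion [IsRightLoop S] : Subgroup (Equiv.Perm S) :=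
  Subgroup.closure {h | ∃ y z : S, h = torsionMap y z}

variable (S) in
/-- A congruence of right loops: an equivalence relation that, as a subset of `S × S`, is closed
under multiplication (this part is Mathlib's `Con`) and under solving `X * a = b`, that is, an
equivalence relation that is a right subloop of `S × S`. -/
structure Congruence extends Con S where
  div' : ∀ {a a' x x' : S}, r a a' → r (x * a) (x' * a') → r x x'

namespace Congruence

/-- `c.Rel x y` says that `x` and `y` are congruent modulo `c`. -/
def Rel (c : Congruence S) (x y : S) : Prop := c.toCon x y

theorem refl (c : Congruence S) (x : S) : c.Rel x x := c.toCon.refl x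

theorem symm (c : Congruence S) {x y : S} (h : c.Rel x y) : c.Rel y x := c.toCon.symm h

theorem trans (c : Congruence S) {x y z : S} (h : c.Rel x y) (h' : c.Rel y z) : c.Rel x z :=
  c.toCon.trans h h'

theorem mul (c : Congruence S) {x y z w : S} (h : c.Rel x y) (h' : c.Rel z w) :
    c.Rel (x * z) (y * w) :=
  c.toCon.mul h h'

theorem div (c : Congruence S) {a a' x x' : S} (h : c.Rel a a')
    (h' : c.Rel (x * a) (x' * a')) : c.Rel x x' :=
  c.div' h h'

/-- The quotient `S / c`, with the induced operation. -/
abbrev Quot (c : Congruence S) : Type u := c.toCon.Quotient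

/-- The natural projection `S → S / c`. -/
def proj (c : Congruence S) : S →* c.Quot where
  toFun x := (x : c.toCon.Quotient)
  map_one' := rfl
  map_mul' _ _ := rfl

theorem proj_eq (c : Congruence S) {x y : S} : c.proj x = c.proj y ↔ c.Rel x y :=
  c.toCon.eq

theorem proj_surjective (c : Congruence S) : Function.Surjective c.proj := fun q =>
  Con.induction_on q fun x => ⟨x, rfl⟩

instance instIsRightLoopQuot [IsRightLoop S] (c : Congruence S) : IsRightLoop c.Quot where
  existsUnique_mul_eq a b := by
    obtain ⟨a, rfl⟩ := c.proj_surjective a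
    obtain ⟨b, rfl⟩ := c.proj_surjective b
    refine ⟨c.proj (rdiv b a), by simp only [← map_mul, rdiv_mul], ?_⟩
    intro x hx
    obtain ⟨x, rfl⟩ := c.proj_surjective x
    rw [← map_mul, c.proj_eq] at hx
    rw [c.proj_eq]
    exact c.div (c.refl a) (by rwa [rdiv_mul])

/-- The equivalence class of the identity (an invariant right subloop of `S`). -/
def oneClass (c : Congruence S) : Submonoid S where
  carrier := {x | c.Rel x 1}
  one_mem' := c.refl 1
  mul_mem' := by
    intro a b ha hb
    simpa using c.mul ha hb

variable (S) in
/-- The equality congruence, whose class of the identity is `{1}`. -/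
def equality [IsRightLoop S] : Congruence S where
  r x y := x = y
  iseqv := eq_equivalence
  mul' := by
    rintro w x y z rfl rfl
    rfl
  div' := by
    rintro a a' x x' rfl h
    exact mul_right_cancel' h

variable (S) in
/-- The total congruence `S × S`. -/
def total : Congruence S where
  r _ _ := True
  iseqv := ⟨fun _ => trivial, fun _ => trivial, fun _ _ => trivial⟩
  mul' _ _ := trivial
  div' _ _ := trivial

/-- The preimage of a congruence on `S / c` under the natural projection. -/
def lift (c : Congruence S) (d : Congruence c.Quot) : Congruence S where
  r x y := d.Rel (c.proj x) (c.proj y)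
  iseqv := ⟨fun _ => d.refl _, fun h => d.symm h, fun h h' => d.trans h h'⟩
  mul' h h' := by
    rw [map_mul, map_mul]
    exact d.mul h h'
  div' h h' := by
    rw [map_mul, map_mul] at h'
    exact d.div h h'

/-- A congruence `b`, regarded as a subset of `S × S` with the induced operation. -/
def pairs (b : Congruence S) : Submonoid (S × S) where
  carrier := {p | b.Rel p.1 p.2}
  one_mem' := b.refl 1
  mul_mem' h h' := b.mul h h'

/-- The element `(x, y)` of a congruence. -/
def pair (b : Congruence S) {x y : S} (h : b.Rel x y) : b.pairs := ⟨(x, y), h⟩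

/-- `d` is a centering congruence by means of which `g` centralizes `b`. Here `d` is a congruence
on the right loop `b ⊆ S × S`. -/
structure IsCentering (g b : Congruence S) (d : Congruence b.pairs) : Prop where
  fst_rel : ∀ {x y u v : S} (h : b.Rel x y) (k : b.Rel u v),
    d.Rel (b.pair h) (b.pair k) → g.Rel x u
  bijOn : ∀ {x y : S} (h : b.Rel x y),
    Set.BijOn (fun p : b.pairs => p.1.1) {p | d.Rel (b.pair h) p} {u | g.Rel x u}
  diag : ∀ {x y : S}, g.Rel x y → d.Rel (b.pair (b.refl x)) (b.pair (b.refl y))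
  swap : ∀ {x y u v : S} (h : b.Rel x y) (k : b.Rel u v),
    d.Rel (b.pair h) (b.pair k) → d.Rel (b.pair (b.symm h)) (b.pair (b.symm k))
  comp : ∀ {x y z u v w : S} (h : b.Rel x y) (k : b.Rel u v) (h' : b.Rel y z) (k' : b.Rel v w),
    d.Rel (b.pair h) (b.pair k) → d.Rel (b.pair h') (b.pair k') →
      d.Rel (b.pair (b.trans h h')) (b.pair (b.trans k k'))

/-- A central congruence: one that is centralized by `S × S`. -/
def IsCentral (a : Congruence S) : Prop :=
  ∃ d : Congruence a.pairs, IsCentering (total S) a d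

end Congruence

variable (S) in
/-- The center congruence of `S`: the join of all central congruences. It is the greatest central
congruence, see `isCentral_centerCon` and `le_centerCon`. -/
def centerCon : Congruence S where
  r x y := ∀ c : Congruence S,
    (∀ a : Congruence S, a.IsCentral → ∀ x y, a.Rel x y → c.Rel x y) → c.Rel x y
  iseqv := ⟨fun _ c _ => c.refl _, fun h c hc => c.symm (h c hc),
    fun h h' c hc => c.trans (h c hc) (h' c hc)⟩
  mul' h h' c hc := c.mul (h c hc) (h' c hc)
  div' h h' c hc := c.div (h c hc) (h' c hc)

theorem le_centerCon {a : Congruence S} (ha : a.IsCentral) {x y : S} (h : a.Rel x y) :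
    (centerCon S).Rel x y :=
  fun _ hc => hc a ha x y h

variable (S) in
/-- The center of `S`: the class of the identity under the center congruence. -/
def center : Submonoid S := (centerCon S).oneClass

/-! ### The center is an abelian group, and the center congruence is the greatest central one -/

/-- Elements that commute and associate with everything. -/
structure IsCentralElt (z : S) : Prop where
  comm : ∀ x, z * x = x * z
  assoc : ∀ x y, z * (x * y) = (z * x) * y
  left_comm : ∀ x y, x * (z * y) = z * (x * y)

theorem IsCentralElt.one : IsCentralElt (1 : S) := ⟨by simp, by simp, by simp⟩

theorem IsCentralElt.mul {z w : S} (hz : IsCentralElt z) (hw : IsCentralElt w) :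
    IsCentralElt (z * w) where
  comm x := by rw [← hz.assoc, hw.comm, ← hz.left_comm]
  assoc x y := by rw [← hz.assoc, ← hz.assoc, hw.assoc, hz.assoc]
  left_comm x y := by rw [← hz.assoc, ← hz.assoc, hz.left_comm, hw.left_comm]

theorem IsCentralElt.mul_mul_mul {z w : S} (hz : IsCentralElt z) (hw : IsCentralElt w) (x y : S) :
    (z * x) * (w * y) = (z * w) * (x * y) := by
  rw [← hz.assoc, ← hz.assoc, hw.left_comm]

theorem IsCentralElt.exists_inv [IsRightLoop S] {z : S} (hz : IsCentralElt z) :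
    ∃ w : S, IsCentralElt w ∧ w * z = 1 ∧ z * w = 1 := by
  obtain ⟨w, hw⟩ : ∃ w : S, w * z = 1 := ⟨rdiv 1 z, rdiv_mul _ _⟩
  have hw' : z * w = 1 := by rw [hz.comm, hw]
  have cancel : ∀ {x y : S}, z * x = z * y → x = y := by
    intro x y h
    rw [hz.comm, hz.comm] at h
    exact mul_right_cancel' h
  refine ⟨w, ⟨fun x => cancel ?_, fun x y => cancel ?_, fun x y => cancel ?_⟩, hw, hw'⟩
  · rw [hz.assoc, hw', ← hz.left_comm, hw', one_mul, mul_one]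
  · rw [hz.assoc, hw', one_mul, hz.assoc, hz.assoc, hw', one_mul]
  · rw [← hz.left_comm, hz.assoc, hz.assoc, hw', one_mul, one_mul]

variable (S) in
/-- Congruence modulo central elements. -/
def eltCon [IsRightLoop S] : Congruence S where
  r x y := ∃ z, IsCentralElt z ∧ x = z * y
  iseqv := by
    refine ⟨fun x => ⟨1, .one, by simp⟩, ?_, ?_⟩
    · rintro x y ⟨z, hz, rfl⟩
      obtain ⟨w, hw, hwz, -⟩ := hz.exists_inv
      exact ⟨w, hw, by rw [hw.assoc, hwz, one_mul]⟩
    · rintro x y t ⟨z, hz, rfl⟩ ⟨w, hw, rfl⟩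
      exact ⟨z * w, hz.mul hw, hz.assoc _ _⟩
  mul' := by
    rintro _ x _ y ⟨z, hz, rfl⟩ ⟨w, hw, rfl⟩
    exact ⟨z * w, hz.mul hw, hz.mul_mul_mul hw _ _⟩
  div' := by
    rintro _ a x y ⟨z, hz, rfl⟩ ⟨w, hw, h⟩
    obtain ⟨v, hv, -, hzv⟩ := hz.exists_inv
    refine ⟨v * w, hv.mul hw, mul_right_cancel' (a := z * a) ?_⟩
    rw [h, (hv.mul hw).mul_mul_mul hz, hv.comm w, ← hw.assoc v z, hv.comm z, hzv, mul_one]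

theorem isCentralElt_of_isCentral [IsRightLoop S] {a : Congruence S} (ha : a.IsCentral) {z : S}
    (hz : a.Rel z 1) : IsCentralElt z := by
  obtain ⟨d, hd⟩ := ha
  have diag : ∀ x, d.Rel (a.pair (a.refl 1)) (a.pair (a.refl x)) := fun x => hd.diag trivial
  -- two pairs related to `(z, 1)` with equal second entries coincide
  have key : ∀ {x x' y : S} (h : a.Rel x y) (h' : a.Rel x' y),
      d.Rel (a.pair hz) (a.pair h) → d.Rel (a.pair hz) (a.pair h') → x = x' := by
    intro x x' y h h' k k'
    have e := (hd.bijOn (a.symm hz)).injOn (hd.swap _ _ k) (hd.swap _ _ k') rfl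
    exact congrArg (fun p : a.pairs => p.1.2) e
  have left : ∀ {x y : S} (h : a.Rel x y) (t : S), d.Rel (a.pair hz) (a.pair h) →
      d.Rel (a.pair hz) (a.pair (a.mul (a.refl t) h)) := by
    intro x y h t k
    have := d.mul (diag t) k
    have e : a.pair (a.refl 1) * a.pair hz = a.pair hz := one_mul _
    rw [e] at this
    exact this
  have right : ∀ {x y : S} (h : a.Rel x y) (t : S), d.Rel (a.pair hz) (a.pair h) →
      d.Rel (a.pair hz) (a.pair (a.mul h (a.refl t))) := by
    intro x y h t k
    have := d.mul k (diag t)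
    have e : a.pair hz * a.pair (a.refl 1) = a.pair hz := mul_one _
    rw [e] at this
    exact this
  have zr : ∀ t : S, ∃ h : a.Rel (z * t) t, d.Rel (a.pair hz) (a.pair h) := by
    intro t
    have := right hz t (d.refl _)
    have h : a.Rel (z * t) t := by simpa using a.mul hz (a.refl t)
    have e : a.pair (a.mul hz (a.refl t)) = a.pair h := Subtype.ext (Prod.ext rfl (one_mul t))
    exact ⟨h, e ▸ this⟩
  have zl : ∀ t : S, ∃ h : a.Rel (t * z) t, d.Rel (a.pair hz) (a.pair h) := by
    intro t
    have := left hz t (d.refl _)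
    have h : a.Rel (t * z) t := by simpa using a.mul (a.refl t) hz
    have e : a.pair (a.mul (a.refl t) hz) = a.pair h := Subtype.ext (Prod.ext rfl (mul_one t))
    exact ⟨h, e ▸ this⟩
  refine ⟨fun x => ?_, fun x y => ?_, fun x y => ?_⟩
  · obtain ⟨h, k⟩ := zr x
    obtain ⟨h', k'⟩ := zl x
    exact key h h' k k'
  · obtain ⟨h, k⟩ := zr (x * y)
    obtain ⟨h', k'⟩ := zr x
    exact key h _ k (right h' y k')
  · obtain ⟨h, k⟩ := zr (x * y)
    obtain ⟨h', k'⟩ := zr y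
    exact key _ h (left h' x k') k

theorem le_eltCon [IsRightLoop S] {x y : S} (h : (centerCon S).Rel x y) :
    (eltCon S).Rel x y := by
  refine h _ fun a ha x y hxy => ?_
  refine ⟨rdiv x y, isCentralElt_of_isCentral ha ?_, (rdiv_mul _ _).symm⟩
  exact a.div (a.refl y) (by rwa [rdiv_mul, one_mul])

theorem isCentral_eltCon [IsRightLoop S] : (eltCon S).IsCentral := by
  refine ⟨{ r := fun p q => ∃ z, IsCentralElt z ∧ p.1.1 = z * p.1.2 ∧ q.1.1 = z * q.1.2
            iseqv := ⟨?_, ?_, ?_⟩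
            mul' := ?_
            div' := ?_ }, ?_⟩
  · rintro ⟨p, z, hz, h⟩
    exact ⟨z, hz, h, h⟩
  · rintro p q ⟨z, hz, h, h'⟩
    exact ⟨z, hz, h', h⟩
  · rintro p q r ⟨z, hz, h, h'⟩ ⟨w, hw, k, k'⟩
    have e : z = w := mul_right_cancel' (h'.symm.trans k)
    subst e
    exact ⟨z, hz, h, k'⟩
  · rintro p q r t ⟨z, hz, h, h'⟩ ⟨w, hw, k, k'⟩
    refine ⟨z * w, hz.mul hw, ?_, ?_⟩
    · change p.1.1 * r.1.1 = _ * (p.1.2 * r.1.2)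
      rw [h, k, hz.mul_mul_mul hw]
    · change q.1.1 * t.1.1 = _ * (q.1.2 * t.1.2)
      rw [h', k', hz.mul_mul_mul hw]
  · rintro p q x y ⟨z, hz, h, h'⟩ ⟨w, hw, k, k'⟩
    obtain ⟨v, hv, -, hzv⟩ := hz.exists_inv
    have aux : ∀ {s s' t t' : S}, t = z * t' → s * t = w * (s' * t') → s = (v * w) * s' := by
      rintro s s' t t' rfl e
      refine mul_right_cancel' (a := z * t') ?_
      rw [e, (hv.mul hw).mul_mul_mul hz, hv.comm w, ← hw.assoc v z, hv.comm z, hzv, mul_one]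
    exact ⟨v * w, hv.mul hw, aux h k, aux h' k'⟩
  · constructor
    · intros
      trivial
    · rintro x y ⟨z, hz, rfl⟩
      obtain ⟨v, hv, hvz, hzv⟩ := hz.exists_inv
      refine ⟨fun _ _ => trivial, ?_, ?_⟩
      · rintro ⟨⟨s, t⟩, hp⟩ ⟨w, hw, e, f⟩ ⟨⟨s', t'⟩, hp'⟩ ⟨w', hw', e', f'⟩ (rfl : s = s')
        have ez : z = w := mul_right_cancel' e
        have ez' : z = w' := mul_right_cancel' e'
        subst ez
        subst ez'
        have e2 : z * t = z * t' := f.symm.trans f'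
        rw [hz.comm, hz.comm] at e2
        have e3 : t = t' := mul_right_cancel' e2
        subst e3
        rfl
      · intro u _
        have hu : u = z * (v * u) := by rw [hz.assoc, hzv, one_mul]
        exact ⟨⟨(u, v * u), z, hz, hu⟩, ⟨z, hz, rfl, hu⟩, rfl⟩
    · intro x y _
      exact ⟨1, .one, (one_mul _).symm, (one_mul _).symm⟩
    · rintro x y u v h k ⟨z, hz, e, f⟩
      obtain ⟨w, hw, hwz, -⟩ := hz.exists_inv
      have e' : x = z * y := e
      have f' : u = z * v := f
      refine ⟨w, hw, ?_, ?_⟩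
      · change y = w * x
        rw [e', hw.assoc, hwz, one_mul]
      · change v = w * u
        rw [f', hw.assoc, hwz, one_mul]
    · rintro x y t u v s h k h' k' ⟨z, hz, e, f⟩ ⟨w, hw, e', f'⟩
      have e1 : x = z * y := e
      have f1 : u = z * v := f
      have e2 : y = w * t := e'
      have f2 : v = w * s := f'
      refine ⟨z * w, hz.mul hw, ?_, ?_⟩
      · change x = (z * w) * t
        rw [e1, e2, hz.assoc]
      · change u = (z * w) * s
        rw [f1, f2, hz.assoc]

theorem centerCon_rel_iff [IsRightLoop S] {x y : S} :
    (centerCon S).Rel x y ↔ (eltCon S).Rel x y :=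
  ⟨le_eltCon, le_centerCon isCentral_eltCon⟩

theorem centerCon_eq_eltCon [IsRightLoop S] : centerCon S = eltCon S := by
  have h : (centerCon S).toCon = (eltCon S).toCon := Con.ext fun _ _ => centerCon_rel_iff
  generalize centerCon S = c at h
  generalize eltCon S = c' at h
  cases c
  cases c'
  cases h
  rfl

theorem isCentral_centerCon [IsRightLoop S] : (centerCon S).IsCentral := by
  rw [centerCon_eq_eltCon]
  exact isCentral_eltCon

theorem mem_center_iff [IsRightLoop S] {z : S} : z ∈ center S ↔ IsCentralElt z := by
  refine centerCon_rel_iff.trans ⟨?_, fun h => ⟨z, h, (mul_one z).symm⟩⟩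
  rintro ⟨w, hw, e⟩
  rw [mul_one] at e
  exact e ▸ hw

/-- The operation of `S` makes the center of `S` an abelian group. -/
noncomputable instance instCommGroupCenter [IsRightLoop S] : CommGroup (center S) where
  mul_assoc a b c := Subtype.ext ((mem_center_iff.1 a.2).assoc _ _).symm
  one_mul := one_mul
  mul_one := mul_one
  inv a := ⟨(mem_center_iff.1 a.2).exists_inv.choose,
    mem_center_iff.2 (mem_center_iff.1 a.2).exists_inv.choose_spec.1⟩
  inv_mul_cancel a := Subtype.ext (mem_center_iff.1 a.2).exists_inv.choose_spec.2.1
  mul_comm a b := Subtype.ext ((mem_center_iff.1 a.2).comm _)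

/-! ### The homomorphism of group torsions induced by a projection -/

theorem proj_torsionMap [IsRightLoop S] (c : Congruence S) (x y z : S) :
    c.proj (torsionMap y z x) = torsionMap (c.proj y) (c.proj z) (c.proj x) := by
  apply mul_right_cancel' (a := c.proj y * c.proj z)
  rw [torsionMap_mul, ← map_mul, ← map_mul, ← map_mul, ← map_mul, torsionMap_mul]

theorem exists_induced [IsRightLoop S] (c : Congruence S) (h : groupTorsion S) :
    ∃ k : groupTorsion c.Quot, ∀ x : S, k.1 (c.proj x) = c.proj (h.1 x) := by
  obtain ⟨h, hh⟩ := h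
  induction hh using Subgroup.closure_induction with
  | mem h hh =>
    obtain ⟨y, z, rfl⟩ := hh
    exact ⟨⟨torsionMap (c.proj y) (c.proj z), Subgroup.subset_closure ⟨_, _, rfl⟩⟩,
      fun x => (proj_torsionMap c x y z).symm⟩
  | one => exact ⟨1, fun _ => rfl⟩
  | mul h h' _ _ ih ih' =>
    obtain ⟨k, hk⟩ := ih
    obtain ⟨k', hk'⟩ := ih'
    refine ⟨k * k', fun x => ?_⟩
    change k.1 (k'.1 (c.proj x)) = _
    rw [hk', hk]
    rfl
  | inv h _ ih =>
    obtain ⟨k, hk⟩ := ih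
    refine ⟨k⁻¹, fun x => ?_⟩
    change k.1⁻¹ (c.proj x) = _
    rw [Equiv.Perm.inv_eq_iff_eq, hk]
    simp

theorem induced_unique [IsRightLoop S] (c : Congruence S) {h : groupTorsion S}
    {k k' : groupTorsion c.Quot} (hk : ∀ x : S, k.1 (c.proj x) = c.proj (h.1 x))
    (hk' : ∀ x : S, k'.1 (c.proj x) = c.proj (h.1 x)) : k = k' := by
  refine Subtype.ext (Equiv.ext fun q => ?_)
  obtain ⟨x, rfl⟩ := c.proj_surjective q
  rw [hk, hk']

/-- The homomorphism `G_S → G_{S/c}` induced by the natural projection. It is the homomorphism with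
`f(y,z) ↦ f([y],[z])`, see `inducedHom_torsionMap`. -/
noncomputable def inducedHom [IsRightLoop S] (c : Congruence S) :
    groupTorsion S →* groupTorsion c.Quot :=
  MonoidHom.mk' (fun h => (exists_induced c h).choose) fun h h' =>
    induced_unique c (exists_induced c (h * h')).choose_spec fun x => by
      change (exists_induced c h).choose.1 ((exists_induced c h').choose.1 (c.proj x)) = _
      rw [(exists_induced c h').choose_spec, (exists_induced c h).choose_spec]
      rfl

theorem inducedHom_apply [IsRightLoop S] (c : Congruence S) (h : groupTorsion S) (x : S) :
    (inducedHom c h).1 (c.proj x) = c.proj (h.1 x) :=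
  (exists_induced c h).choose_spec x

theorem inducedHom_torsionMap [IsRightLoop S] (c : Congruence S) (y z : S) :
    inducedHom c ⟨torsionMap y z, Subgroup.subset_closure ⟨y, z, rfl⟩⟩ =
      ⟨torsionMap (c.proj y) (c.proj z), Subgroup.subset_closure ⟨_, _, rfl⟩⟩ :=
  induced_unique c (inducedHom_apply c _) fun x => (proj_torsionMap c x y z).symm

end Basic

/-! ### The central series -/

section Series

variable (S : Type u) [MulOneClass S] [IsRightLoop S]

/-- The congruences of the central series: the `0`-th one is equality, and the `(i+1)`-st one is
the preimage in `S` of the center congruence of the quotient of `S` by the `i`-th one. -/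
def seriesCon : ℕ → Congruence S
  | 0 => Congruence.equality S
  | i + 1 => (seriesCon i).lift (centerCon (seriesCon i).Quot)

/-- The term `Z_i` of the central series. -/
def centralTerm (i : ℕ) : Submonoid S := (seriesCon S i).oneClass

/-- The quotient `S / Z_i`. -/
abbrev SeriesQuot (i : ℕ) : Type u := (seriesCon S i).Quot

/-- The factor `Z_{i+1} / Z_i`: the image of `Z_{i+1}` in `S / Z_i`. -/
def centralFactor (i : ℕ) : Submonoid (SeriesQuot S i) :=
  (centralTerm S (i + 1)).map (seriesCon S i).proj

theorem centralTerm_zero : centralTerm S 0 = ⊥ := rfl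

theorem centralFactor_eq (i : ℕ) : centralFactor S i = center (SeriesQuot S i) := by
  ext q
  constructor
  · rintro ⟨x, hx, rfl⟩
    exact hx
  · intro hq
    obtain ⟨x, rfl⟩ := (seriesCon S i).proj_surjective q
    exact ⟨x, hq, rfl⟩

theorem centralTerm_le_succ (i : ℕ) : centralTerm S i ≤ centralTerm S (i + 1) := by
  intro x hx
  have e : (seriesCon S i).proj x = (seriesCon S i).proj 1 := (seriesCon S i).proj_eq.2 hx
  change (centerCon _).Rel ((seriesCon S i).proj x) ((seriesCon S i).proj 1)
  rw [e]
  exact Congruence.refl _ _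

variable {S} in
theorem mem_centralFactor_iff {i : ℕ} {q : SeriesQuot S i} :
    q ∈ centralFactor S i ↔ IsCentralElt q := by
  rw [centralFactor_eq, mem_center_iff]

/-- The operation of `S / Z_i` makes `Z_{i+1} / Z_i` an abelian group. -/
noncomputable instance instCommGroupCentralFactor (i : ℕ) : CommGroup (centralFactor S i) where
  mul_assoc a b c := Subtype.ext ((mem_centralFactor_iff.1 a.2).assoc _ _).symm
  one_mul := one_mul
  mul_one := mul_one
  inv a := ⟨(mem_centralFactor_iff.1 a.2).exists_inv.choose,
    mem_centralFactor_iff.2 (mem_centralFactor_iff.1 a.2).exists_inv.choose_spec.1⟩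
  inv_mul_cancel a := Subtype.ext (mem_centralFactor_iff.1 a.2).exists_inv.choose_spec.2.1
  mul_comm a b := Subtype.ext ((mem_centralFactor_iff.1 a.2).comm _)

/-- `1 = Z_0 ≤ Z_1 ≤ … ≤ Z_n = S` is a central series of `S`; so `S` is nilpotent if and only if
this holds for some `n`. -/
def HasCentralSeries (n : ℕ) : Prop := centralTerm S n = ⊤

/-- A nilpotent right loop. -/
def IsNilpotent : Prop := ∃ n : ℕ, HasCentralSeries S n

/-- The homomorphism `θ_j : G_S → G_{S/Z_j}` induced by the natural projection `S → S / Z_j`. -/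
noncomputable def theta (j : ℕ) : groupTorsion S →* groupTorsion (SeriesQuot S j) :=
  inducedHom (seriesCon S j)

end Series

end RightLoop

namespace RightLoop

/-! ### Kernels of induced maps, and torsion against central elements -/

section Torsion

variable {S : Type u} [MulOneClass S] [IsRightLoop S]

/-! An element `h` of the group torsion lies in `Ker θ_{j+1}` exactly when it moves each point
inside its class modulo `Z_{j+1}`. Seen in `S / Z_j`, this says that `θ_j h` sends each `q` to `z_q
* q` with `z_q` central. Right cancellation makes `z_q` unique.

The key fact is that torsion permutations commute with multiplication by central elements
(`IsCentralElt.groupTorsion_apply_mul`). Hence for `h, h'` with factors `z_q, z'_q`, the product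
sends `q` to `θ_j h (z'_q * q) = z'_q * (z_q * q)`. So the factors multiply pointwise, and `h ↦ (q ↦
z_q)` is a homomorphism into a power of `Z_{j+1} / Z_j` (`displacement`). All factors are `1`
exactly when `θ_j h = 1` (`displacement_ker`), and the first isomorphism theorem gives the
embedding.

At the top of the chain, `S / Z_{n-1}` consists of central elements, so it is associative and its
torsion is trivial. -/

theorem mem_ker_inducedHom {c : Congruence S} {h : groupTorsion S} :
    h ∈ (inducedHom c).ker ↔ ∀ x : S, c.Rel (h.1 x) x := by
  rw [MonoidHom.mem_ker]
  constructor
  · intro e x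
    rw [← c.proj_eq, ← inducedHom_apply, e]
    rfl
  · intro e
    exact induced_unique c (inducedHom_apply c h) fun x => (c.proj_eq.2 (e x)).symm

/-- The group torsion commutes with multiplication by central elements. -/
theorem IsCentralElt.groupTorsion_apply_mul {c : S} (hc : IsCentralElt c) {h : Equiv.Perm S}
    (hh : h ∈ groupTorsion S) (x : S) : h (c * x) = c * h x := by
  induction hh using Subgroup.closure_induction generalizing x with
  | mem h hh =>
    obtain ⟨y, z, rfl⟩ := hh
    -- After multiplying by `y * z`, both sides become `c * ((x * y) * z)`.
    apply mul_right_cancel' (a := y * z)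
    rw [torsionMap_mul, ← hc.assoc, ← hc.assoc, ← hc.assoc, torsionMap_mul]
  | one => rfl
  | mul h h' _ _ ih ih' => rw [Equiv.Perm.mul_apply, Equiv.Perm.mul_apply, ih', ih]
  | inv h _ ih =>
    rw [Equiv.Perm.inv_eq_iff_eq, ih]
    exact congrArg (c * ·) (h.apply_symm_apply x).symm

/-- Each generator `f(y,z)` measures the failure of associativity, and central elements associate
with everything. -/
theorem groupTorsion_eq_bot_of_isCentralElt (hS : ∀ x : S, IsCentralElt x) :
    groupTorsion S = ⊥ := by
  rw [groupTorsion, Subgroup.closure_eq_bot_iff]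
  rintro _ ⟨y, z, rfl⟩
  refine Equiv.ext fun x => mul_right_cancel' (a := y * z) ?_
  rw [torsionMap_mul, Equiv.Perm.one_apply, (hS x).assoc]

end Torsion

/-! ### The chain of kernels and its factors -/

section Series

variable (S : Type u) [MulOneClass S] [IsRightLoop S]

theorem theta_zero_ker : (theta S 0).ker = ⊥ := by
  rw [eq_bot_iff]
  intro h hh
  exact Subgroup.mem_bot.2 (Subtype.ext (Equiv.ext (mem_ker_inducedHom.1 hh)))

theorem theta_ker_le_succ (j : ℕ) : (theta S j).ker ≤ (theta S (j + 1)).ker := by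
  intro h hh
  refine mem_ker_inducedHom.2 fun x => ?_
  -- By definition, congruence modulo `Z_{j+1}` is pulled back from the center congruence of `S /
  -- Z_j`, where the two images already coincide.
  change (centerCon _).Rel ((seriesCon S j).proj (h.1 x)) ((seriesCon S j).proj x)
  rw [(seriesCon S j).proj_eq.2 (mem_ker_inducedHom.1 hh x)]
  exact Congruence.refl _ _

theorem theta_ker_eq_top {j : ℕ} (hS : HasCentralSeries S (j + 1)) : (theta S j).ker = ⊤ := by
  have hc : ∀ q : SeriesQuot S j, IsCentralElt q := by
    intro q
    obtain ⟨x, rfl⟩ := (seriesCon S j).proj_surjective q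
    exact mem_centralFactor_iff.1 ⟨x, hS ▸ Submonoid.mem_top x, rfl⟩
  rw [eq_top_iff]
  intro h _
  rw [MonoidHom.mem_ker]
  refine Subtype.ext (Subgroup.mem_bot.1 ?_)
  rw [← groupTorsion_eq_bot_of_isCentralElt hc]
  exact (theta S j h).2

variable {S}

/-- Elements congruent modulo the center differ by a central left factor, by `le_eltCon`. -/
theorem exists_theta_apply_eq_mul {j : ℕ} {h : groupTorsion S} (hh : h ∈ (theta S (j + 1)).ker)
    (q : SeriesQuot S j) : ∃ z : centralFactor S j, (theta S j h).1 q = z * q := by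
  obtain ⟨x, rfl⟩ := (seriesCon S j).proj_surjective q
  have e : (centerCon _).Rel ((seriesCon S j).proj (h.1 x)) ((seriesCon S j).proj x) :=
    mem_ker_inducedHom.1 hh x
  obtain ⟨z, hz, e⟩ := le_eltCon e
  exact ⟨⟨z, mem_centralFactor_iff.2 hz⟩, (inducedHom_apply _ h x).trans e⟩

variable (S)

/-- An element of `Ker θ_{j+1}` moves every `q : S / Z_j` by a factor in `Z_{j+1} / Z_j`; this is
the homomorphism that records these factors. -/
noncomputable def displacement (j : ℕ) :
    (theta S (j + 1)).ker →* (SeriesQuot S j → centralFactor S j) :=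
  MonoidHom.mk' (fun h q => (exists_theta_apply_eq_mul h.2 q).choose) fun h h' => by
    funext q
    have e := (exists_theta_apply_eq_mul (h * h').2 q).choose_spec
    have e₁ := (exists_theta_apply_eq_mul h.2 q).choose_spec
    have e₂ := (exists_theta_apply_eq_mul h'.2 q).choose_spec
    refine Subtype.ext (mul_right_cancel' (a := q) (e.symm.trans ?_))
    -- The factor of `h'` at `q` is pulled out through `θ_j h`, so the factor of `h` is also taken
    -- at `q`, not at the moved point.
    rw [Subgroup.coe_mul, map_mul, Subgroup.coe_mul, Equiv.Perm.mul_apply, e₂,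
      (mem_centralFactor_iff.1 (Subtype.prop _)).groupTorsion_apply_mul (theta S j h).2, e₁,
      (mem_centralFactor_iff.1 (Subtype.prop _)).assoc]
    -- The two factors come out in reversed order; centrality swaps them.
    exact congrArg (· * q) ((mem_centralFactor_iff.1 (Subtype.prop _)).comm _)

theorem displacement_mul (j : ℕ) (h : (theta S (j + 1)).ker) (q : SeriesQuot S j) :
    (displacement S j h q : SeriesQuot S j) * q = (theta S j h).1 q :=
  (exists_theta_apply_eq_mul h.2 q).choose_spec.symm

theorem displacement_ker (j : ℕ) :
    (displacement S j).ker = (theta S j).ker.subgroupOf (theta S (j + 1)).ker := by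
  ext h
  rw [Subgroup.mem_subgroupOf, MonoidHom.mem_ker, MonoidHom.mem_ker]
  constructor
  · intro e
    refine Subtype.ext (Equiv.ext fun q => ?_)
    rw [← displacement_mul, e]
    exact one_mul q
  · intro e
    funext q
    refine Subtype.ext (mul_right_cancel' (a := q) ?_)
    rw [displacement_mul, e]
    exact (one_mul q).symm

end Series

end RightLoop

theorem mainTheorem4 {S : Type u} [MulOneClass S] [IsRightLoop S] (n : ℕ) (hn : 1 ≤ n)
    (hS : RightLoop.HasCentralSeries S n) :
    (RightLoop.theta S 0).ker = ⊥ ∧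
    (∀ j : ℕ, j + 1 ≤ n - 1 → (RightLoop.theta S j).ker ≤ (RightLoop.theta S (j + 1)).ker) ∧
    (RightLoop.theta S (n - 1)).ker = ⊤ ∧
    (∀ j : ℕ, j + 1 ≤ n - 1 →
      ∃ (B : Type u) (K : Subgroup (B → RightLoop.centralFactor S j)),
        Nonempty (((RightLoop.theta S (j + 1)).ker ⧸
          (RightLoop.theta S j).ker.subgroupOf (RightLoop.theta S (j + 1)).ker) ≃* K)) := by
  refine ⟨RightLoop.theta_zero_ker S, fun j _ => RightLoop.theta_ker_le_succ S j,
    RightLoop.theta_ker_eq_top S ?_, fun j _ => ?_⟩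
  · rwa [Nat.sub_add_cancel hn]
  -- The index set is `S / Z_j` itself: one coordinate for each point moved.
  · exact ⟨RightLoop.SeriesQuot S j, (RightLoop.displacement S j).range,
      ⟨(QuotientGroup.quotientMulEquivOfEq (RightLoop.displacement_ker S j).symm).trans
        (QuotientGroup.quotientKerEquivRange (RightLoop.displacement S j))⟩⟩
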